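/- A Motzkin tree is a rooted plane unary-binary tree, and its size is its total number of nodes. A closed lambda-term (up to renaming of bound variables) is a Motzkin tree in which each leaf (variable) carries a pointer to exactly one of the unary nodes (abstractions) among its ancestors; its size is the total number of nodes of the tree. For an integer $p\ge 0$, a $BCK(p)$-term is a closed lambda-term in which every unary node binds (is pointed to by) at most $p$ leaves. Let $f_n^{(p)}$ be the number of $BCK(p)$-terms of size $n$ and $F_p(z)=\sum_{n\ge 1} f_n^{(p)}z^n$. Let $M(z,u)$ be the bivariate generating function of Motzkin trees, where $z$ marks the size and $u$ marks the number of leaves. All series are formal power series with real coefficients. **Proposition.** (i) $M(z,u)$ is the unique formal power series solution of $M=uz+zM+zM^2$, that is, $$M(z,u)=\frac{1-z-\sqrt{(1-z)^2-4uz^2}}{2z},$$ where the square root is the formal power series with constant term $1$ whose square is $(1-z)^2-4uz^2$. (ii) For every integer $p\ge 0$, $F_p(z)$ is the unique formal power series $F(z)$ satisfying $$F(z)=z\,[u^p]\frac{M(z,u)}{1-u}+z\,F(z)^2+z\,[u^p]\left(\frac{1}{1-u}\,F\!\left(\frac{z}{1-2z\,M(z,u)}\right)\right).$$ -/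

import Mathlib

/-- Motzkin trees: rooted plane unary-binary trees. -/
inductive MotzkinTree : Type
  | leaf : MotzkinTree
  | unary : MotzkinTree → MotzkinTree
  | binary : MotzkinTree → MotzkinTree → MotzkinTree

namespace MotzkinTree

/-- Total number of nodes. -/
def size : MotzkinTree → ℕ
  | leaf => 1
  | unary t => t.size + 1
  | binary s t => s.size + t.size + 1

/-- Number of leaves. -/
def leaves : MotzkinTree → ℕ
  | leaf => 1
  | unary t => t.leaves
  | binary s t => s.leaves + t.leaves

theorem finite_size_le (n : ℕ) : {t : MotzkinTree | t.size ≤ n}.Finite := by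
  induction n with
  | zero =>
    refine Set.Finite.subset Set.finite_empty ?_
    intro t ht
    cases t <;> simp [size] at ht
  | succ n ih =>
    refine ((Set.finite_singleton leaf).union
      ((ih.image unary).union (ih.image2 binary ih))).subset ?_
    intro t ht
    cases t with
    | leaf => exact Or.inl rfl
    | unary t =>
      exact Or.inr (Or.inl ⟨t, by simp only [Set.mem_ofPred_eq, size] at ht ⊢; omega, rfl⟩)
    | binary s t =>
      exact Or.inr (Or.inr ⟨s, by simp only [Set.mem_ofPred_eq, size] at ht ⊢; omega,
        t, by simp only [Set.mem_ofPred_eq, size] at ht ⊢; omega, rfl⟩)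

/-- The sets counted by the generating function `motzkinGF` are finite. -/
theorem finite_size_leaves (n k : ℕ) : {t : MotzkinTree | t.size = n ∧ t.leaves = k}.Finite :=
  (finite_size_le n).subset fun _ ht => ht.1.le

end MotzkinTree

/-- Lambda-terms (up to renaming of bound variables) whose free variables are among `m` variables.
`LambdaTerm 0` is the type of closed lambda-terms. A term is a unary-binary tree in which
each leaf carries a pointer to one of the `m` free variables or to one of the unary nodes
(abstractions) above it: below an abstraction the index `0` designates that abstraction,
and the older indices are shifted by one. -/
inductive LambdaTerm : ℕ → Type
  | var {m : ℕ} (i : Fin m) : LambdaTerm m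
  | lam {m : ℕ} (t : LambdaTerm (m + 1)) : LambdaTerm m
  | app {m : ℕ} (s t : LambdaTerm m) : LambdaTerm m

namespace LambdaTerm

/-- Total number of nodes: leaves (variables), unary nodes (abstractions) and binary nodes
(applications). -/
def size : {m : ℕ} → LambdaTerm m → ℕ
  | _, var _ => 1
  | _, lam t => t.size + 1
  | _, app s t => s.size + t.size + 1

/-- Number of leaves pointing to the variable `i`. -/
def occ : {m : ℕ} → LambdaTerm m → Fin m → ℕ
  | _, var j, i => if j = i then 1 else 0
  | _, lam t, i => t.occ i.succ
  | _, app s t, i => s.occ i + t.occ i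

/-- Every abstraction binds at most `p` leaves. -/
def BindsAtMost (p : ℕ) : {m : ℕ} → LambdaTerm m → Prop
  | _, var _ => True
  | _, lam t => t.occ 0 ≤ p ∧ BindsAtMost p t
  | _, app s t => BindsAtMost p s ∧ BindsAtMost p t

theorem finite_size_le (n m : ℕ) : {t : LambdaTerm m | t.size ≤ n}.Finite := by
  induction n generalizing m with
  | zero =>
    refine Set.Finite.subset Set.finite_empty ?_
    intro t ht
    cases t <;> simp [size] at ht
  | succ n ih =>
    refine ((Set.finite_range var).union
      (((ih (m + 1)).image lam).union ((ih m).image2 app (ih m)))).subset ?_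
    intro t ht
    cases t with
    | var i => exact Or.inl ⟨i, rfl⟩
    | lam t =>
      exact Or.inr (Or.inl ⟨t, by simp only [Set.mem_ofPred_eq, size] at ht ⊢; omega, rfl⟩)
    | app s t =>
      exact Or.inr (Or.inr ⟨s, by simp only [Set.mem_ofPred_eq, size] at ht ⊢; omega,
        t, by simp only [Set.mem_ofPred_eq, size] at ht ⊢; omega, rfl⟩)

end LambdaTerm

/-- `BCK(p)`: closed lambda-terms in which every abstraction binds at most `p` leaves. -/
def BCK (p : ℕ) : Set (LambdaTerm 0) := {t | t.BindsAtMost p}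

/-- The sets counted by the generating function `bckGF` are finite. -/
theorem BCK_finite (p n : ℕ) : {t : LambdaTerm 0 | t ∈ BCK p ∧ t.size = n}.Finite :=
  (LambdaTerm.finite_size_le n 0).subset fun _ ht => ht.2.le

/-- `F_p(z) = ∑ f_n z^n`, where `f_n` is the number of `BCK(p)`-terms of size `n`. -/
noncomputable def bckGF (p : ℕ) : PowerSeries ℝ :=
  PowerSeries.mk fun n => ({t : LambdaTerm 0 | t ∈ BCK p ∧ t.size = n}.ncard : ℝ)

/-- Formal power series in `z` and `u` with real coefficients (`z` is variable `0`, `u` is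
variable `1`). -/
abbrev BivSeries : Type := MvPowerSeries (Fin 2) ℝ

/-- The variable `z`. -/
noncomputable def zVar : BivSeries := MvPowerSeries.X 0

/-- The variable `u`. -/
noncomputable def uVar : BivSeries := MvPowerSeries.X 1

/-- `[u^p] G(z,u)`, a power series in `z`. -/
noncomputable def uCoeff (p : ℕ) (G : BivSeries) : PowerSeries ℝ :=
  PowerSeries.mk fun n => MvPowerSeries.coeff (Finsupp.single 0 n + Finsupp.single 1 p) G

/-- `M(z,u)`: the coefficient of `z^n u^k` is the number of Motzkin trees with `n` nodes and `k`
leaves. -/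
noncomputable def motzkinGF : BivSeries :=
  fun e => ({t : MotzkinTree | t.size = e 0 ∧ t.leaves = e 1}.ncard : ℝ)

/-- The series `z / (1 - 2 z M(z,u))`. -/
noncomputable def motzkinArg : BivSeries := zVar * (1 - 2 * zVar * motzkinGF)⁻¹

/-- The denominators `1 - u` and `1 - 2 z M(z,u)` are invertible, and `z / (1 - 2 z M(z,u))` can
be substituted into every power series, so that no default values enter. -/
theorem one_sub_uVar_mul_inv : (1 - uVar) * (1 - uVar)⁻¹ = 1 :=
  MvPowerSeries.mul_inv_cancel _ (by simp [uVar])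

theorem motzkinArg_denominator_mul_inv :
    (1 - 2 * zVar * motzkinGF) * (1 - 2 * zVar * motzkinGF)⁻¹ = 1 :=
  MvPowerSeries.mul_inv_cancel _ (by simp [zVar])

theorem motzkinArg_hasSubst : PowerSeries.HasSubst motzkinArg :=
  PowerSeries.HasSubst.of_constantCoeff_zero (by simp [motzkinArg, zVar])

/-! Disjoint unions, products and injective images of weighted sets become sums, products and
monomial multiples of series. Splitting a Motzkin tree at its root gives the quadratic equation for
`motzkinGF`.

For (ii), a closed term is an application, which gives `X * F ^ 2`, or an abstraction over a term
`t` with one free variable `x`. Delete from `t` each maximal subterm whose leaves all point to `x`,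
together with the application above it (`strip`). If nothing remains, `t` is a Motzkin tree with all
leaves labelled `x`, which contributes `motzkinGF`. Otherwise a closed term `c` remains. No deleted
leaf was bound by an abstraction inside `t`, so `t` and `c` satisfy the same binding bounds
(`strip_some`). To recover `t`, a finite sequence of applications is inserted above each node of
`c`, each with a Motzkin tree on its left or right, so every node is worth `z / (1 - 2 z M)`
(`weightGF_stripFiber`). Summing over `c` substitutes this series into `F`. Finally, dividing by `1
- u` and taking `[u^p]` keeps the terms with at most `p` occurrences of `x`.

Uniqueness holds because every occurrence of `F` on the right-hand side carries a factor `z`, and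
the substitution does not lower the order in `z`. -/

/-- The generating function of the set `A`, where `a` is counted with the exponent `w a`. -/
noncomputable def weightGF {σ α : Type*} (w : α → σ →₀ ℕ) (A : Set α) : MvPowerSeries σ ℝ :=
  fun e => ({a | a ∈ A ∧ w a = e}.ncard : ℝ)

namespace weightGF

variable {σ α β : Type*}

theorem coeff_eq (w : α → σ →₀ ℕ) (A : Set α) (e : σ →₀ ℕ) :
    MvPowerSeries.coeff e (weightGF w A) = ({a | a ∈ A ∧ w a = e}.ncard : ℝ) := rfl

theorem finite_fiber {w : α → σ →₀ ℕ} (hw : ∀ e, {a | w a = e}.Finite) (A : Set α) (e : σ →₀ ℕ) :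
    {a | a ∈ A ∧ w a = e}.Finite :=
  (hw e).subset fun _ h => h.2

/-- Finite fibres matter here: `Set.ncard` is `0` on infinite sets, so additivity could fail without
them. For injective images no such condition is needed. -/
theorem union {w : α → σ →₀ ℕ} (hw : ∀ e, {a | w a = e}.Finite) {A B : Set α}
    (h : Disjoint A B) : weightGF w (A ∪ B) = weightGF w A + weightGF w B := by
  ext e
  rw [map_add, coeff_eq, coeff_eq, coeff_eq, ← Nat.cast_add,
    ← Set.ncard_union_eq _ (finite_fiber hw A e) (finite_fiber hw B e)]
  · congr 2
    ext a
    simp only [Set.mem_ofPred_eq, Set.mem_union]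
    tauto
  · exact h.mono (fun _ h => h.1) (fun _ h => h.1)

theorem image {w : α → σ →₀ ℕ} {w' : β → σ →₀ ℕ} {f : α → β} (hf : f.Injective)
    (d : σ →₀ ℕ) (hd : ∀ a, w' (f a) = d + w a) (A : Set α) :
    weightGF w' (f '' A) = MvPowerSeries.monomial d 1 * weightGF w A := by
  classical
  ext e
  rw [MvPowerSeries.coeff_monomial_mul, coeff_eq, coeff_eq, one_mul]
  split_ifs with h
  · rw [← Set.ncard_image_of_injective _ hf]
    congr 2
    ext b
    simp only [Set.mem_ofPred_eq, Set.mem_image]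
    constructor
    · rintro ⟨⟨a, ha, rfl⟩, h'⟩
      refine ⟨a, ⟨ha, ?_⟩, rfl⟩
      rw [← h', hd, add_tsub_cancel_left]
    · rintro ⟨a, ⟨ha, h'⟩, rfl⟩
      refine ⟨⟨a, ha, rfl⟩, ?_⟩
      rw [hd, h', add_tsub_cancel_of_le h]
  · rw [Nat.cast_eq_zero]
    convert Set.ncard_empty β
    rw [Set.eq_empty_iff_forall_notMem]
    rintro b ⟨⟨a, ha, rfl⟩, h'⟩
    exact h (by rw [← h', hd]; exact le_self_add)

theorem prod {w : α → σ →₀ ℕ} {w' : β → σ →₀ ℕ} (hw : ∀ e, {a | w a = e}.Finite)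
    (hw' : ∀ e, {b | w' b = e}.Finite) (A : Set α) (B : Set β) :
    weightGF (fun x : α × β => w x.1 + w' x.2) (A ×ˢ B) = weightGF w A * weightGF w' B := by
  classical
  ext e
  rw [MvPowerSeries.coeff_mul, coeff_eq]
  have key : {x : α × β | x ∈ A ×ˢ B ∧ w x.1 + w' x.2 = e} =
      ((Finset.HasAntidiagonal.antidiagonal e).biUnion fun d =>
        (finite_fiber hw A d.1).toFinset ×ˢ (finite_fiber hw' B d.2).toFinset :
          Finset (α × β)) := by
    ext ⟨a, b⟩
    simp only [Set.mem_ofPred_eq, Set.mem_prod, Finset.coe_biUnion, Set.mem_iUnion, Finset.mem_coe,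
      Finset.HasAntidiagonal.mem_antidiagonal, Finset.mem_product, Set.Finite.mem_toFinset, exists_prop]
    constructor
    · rintro ⟨⟨ha, hb⟩, h⟩
      exact ⟨(w a, w' b), h, ⟨ha, rfl⟩, hb, rfl⟩
    · rintro ⟨d, h, ⟨ha, h1⟩, hb, h2⟩
      exact ⟨⟨ha, hb⟩, by rw [h1, h2, h]⟩
  rw [key, Set.ncard_coe_finset, Finset.card_biUnion, Nat.cast_sum]
  · refine Finset.sum_congr rfl fun d _ => ?_
    rw [Finset.card_product, coeff_eq, coeff_eq, Nat.cast_mul,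
      Set.ncard_eq_toFinset_card _ (finite_fiber hw A d.1),
      Set.ncard_eq_toFinset_card _ (finite_fiber hw' B d.2)]
  · intro d _ d' _ hne
    rw [Function.onFun, Finset.disjoint_left]
    rintro ⟨a, b⟩ h h'
    simp only [Finset.mem_product, Set.Finite.mem_toFinset, Set.mem_ofPred_eq] at h h'
    exact hne (Prod.ext (h.1.2.symm.trans h'.1.2) (h.2.2.symm.trans h'.2.2))

theorem image2 {γ : Type*} {w : α → σ →₀ ℕ} {w' : β → σ →₀ ℕ} {w'' : γ → σ →₀ ℕ}
    (hw : ∀ e, {a | w a = e}.Finite) (hw' : ∀ e, {b | w' b = e}.Finite) {f : α → β → γ}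
    (hf : Function.Injective2 f) (d : σ →₀ ℕ) (hd : ∀ a b, w'' (f a b) = d + (w a + w' b))
    (A : Set α) (B : Set β) :
    weightGF w'' (Set.image2 f A B) =
      MvPowerSeries.monomial d 1 * (weightGF w A * weightGF w' B) := by
  rw [← prod hw hw', ← image (w' := w'') hf.uncurry d fun x => hd x.1 x.2, ← Set.image_uncurry_prod]

theorem singleton (w : α → σ →₀ ℕ) (a : α) :
    weightGF w {a} = MvPowerSeries.monomial (w a) 1 := by
  classical
  ext e
  rw [coeff_eq, MvPowerSeries.coeff_monomial]
  split_ifs with h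
  · have : {b | b ∈ ({a} : Set α) ∧ w b = e} = {a} := by
      ext b
      simp only [Set.mem_ofPred_eq, Set.mem_singleton_iff]
      exact ⟨fun h => h.1, by rintro rfl; exact ⟨rfl, h.symm⟩⟩
    rw [this, Set.ncard_singleton, Nat.cast_one]
  · have : {b | b ∈ ({a} : Set α) ∧ w b = e} = ∅ := by
      rw [Set.eq_empty_iff_forall_notMem]
      rintro b ⟨rfl, h'⟩
      exact h h'.symm
    rw [this, Set.ncard_empty, Nat.cast_zero]

end weightGF

/-! ### Motzkin trees and their quadratic equation -/

/-- The exponent of `z ^ n * u ^ k`. -/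
noncomputable def bivExp (n k : ℕ) : Fin 2 →₀ ℕ := Finsupp.single 0 n + Finsupp.single 1 k

theorem bivExp_add (n k n' k' : ℕ) : bivExp n k + bivExp n' k' = bivExp (n + n') (k + k') := by
  simp only [bivExp, Finsupp.single_add]
  abel

@[simp] theorem bivExp_zero (n k : ℕ) : bivExp n k 0 = n := by simp [bivExp]

@[simp] theorem bivExp_one (n k : ℕ) : bivExp n k 1 = k := by simp [bivExp]

theorem eq_bivExp_iff (n k : ℕ) (e : Fin 2 →₀ ℕ) : bivExp n k = e ↔ n = e 0 ∧ k = e 1 := by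
  rw [Finsupp.ext_iff, Fin.forall_fin_two, bivExp_zero, bivExp_one]

theorem monomial_bivExp_one_zero : MvPowerSeries.monomial (bivExp 1 0) (1 : ℝ) = zVar := by
  simp [bivExp, zVar, MvPowerSeries.X]

theorem monomial_bivExp_one_one :
    MvPowerSeries.monomial (bivExp 1 1) (1 : ℝ) = uVar * zVar := by
  rw [uVar, zVar, MvPowerSeries.X, MvPowerSeries.X, MvPowerSeries.monomial_mul_monomial, one_mul,
    bivExp, add_comm]

namespace MotzkinTree

/-- The exponent with which a tree is counted in `motzkinGF`. -/
noncomputable def weight (t : MotzkinTree) : Fin 2 →₀ ℕ := bivExp t.size t.leaves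

theorem finite_weight (e : Fin 2 →₀ ℕ) : {t : MotzkinTree | t.weight = e}.Finite :=
  (finite_size_leaves (e 0) (e 1)).subset fun _ h => (eq_bivExp_iff _ _ _).1 h

end MotzkinTree

theorem motzkinGF_eq_weightGF : motzkinGF = weightGF MotzkinTree.weight Set.univ := by
  funext e
  simp only [motzkinGF, weightGF, MotzkinTree.weight, eq_bivExp_iff, Set.mem_univ, true_and]

theorem motzkinGF_eq : motzkinGF = uVar * zVar + zVar * motzkinGF + zVar * motzkinGF ^ 2 := by
  have huniv : (Set.univ : Set MotzkinTree) = ({MotzkinTree.leaf} ∪ MotzkinTree.unary '' Set.univ) ∪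
      Set.image2 MotzkinTree.binary Set.univ Set.univ := by
    refine (Set.eq_univ_of_forall fun t => ?_).symm
    cases t <;> simp
  have hd : Disjoint {MotzkinTree.leaf} (MotzkinTree.unary '' Set.univ) := by
    simp
  have hd' : Disjoint ({MotzkinTree.leaf} ∪ MotzkinTree.unary '' Set.univ)
      (Set.image2 MotzkinTree.binary Set.univ Set.univ) := by
    rw [Set.disjoint_left]
    rintro _ (rfl | ⟨t, -, rfl⟩) <;> simp
  conv_lhs =>
    rw [motzkinGF_eq_weightGF, huniv, weightGF.union MotzkinTree.finite_weight hd',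
      weightGF.union MotzkinTree.finite_weight hd, weightGF.singleton,
      weightGF.image (w := MotzkinTree.weight) (fun _ _ h => MotzkinTree.unary.inj h) (bivExp 1 0)
        (fun t => by
          simp [MotzkinTree.weight, MotzkinTree.size, MotzkinTree.leaves, bivExp_add, add_comm]),
      weightGF.image2 MotzkinTree.finite_weight MotzkinTree.finite_weight
        (fun _ _ _ _ h => MotzkinTree.binary.inj h) (bivExp 1 0)
        (fun s t => by
          simp [MotzkinTree.weight, MotzkinTree.size, MotzkinTree.leaves, bivExp_add, add_comm]),
      ← motzkinGF_eq_weightGF, MotzkinTree.weight, MotzkinTree.size, MotzkinTree.leaves,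
      monomial_bivExp_one_zero, monomial_bivExp_one_one, ← sq]

/-- Subtracting the two equations leaves the factor `1 - z (1 + N + M)`, which has constant term `1`
and is therefore nonzero in an integral domain. -/
theorem eq_motzkinGF_iff (N : BivSeries) :
    N = uVar * zVar + zVar * N + zVar * N ^ 2 ↔ N = motzkinGF := by
  refine ⟨fun h => ?_, fun h => h ▸ motzkinGF_eq⟩
  have h0 : (N - motzkinGF) * (1 - zVar * (1 + N + motzkinGF)) = 0 := by
    linear_combination h - motzkinGF_eq
  rcases mul_eq_zero.1 h0 with h1 | h1
  · exact sub_eq_zero.1 h1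
  · have := congrArg MvPowerSeries.constantCoeff h1
    simp [zVar] at this

theorem exists_sqrt_motzkinGF : ∃ S : BivSeries, MvPowerSeries.constantCoeff S = 1 ∧
    S ^ 2 = (1 - zVar) ^ 2 - 4 * uVar * zVar ^ 2 ∧ 2 * zVar * motzkinGF = 1 - zVar - S := by
  -- The root is read off from the formula for `M`; completing the square in the quadratic equation
  -- shows that it squares to the discriminant.
  refine ⟨1 - zVar - 2 * zVar * motzkinGF, by simp [zVar], ?_, by ring⟩
  linear_combination (-4 * zVar) * motzkinGF_eq
-- Stripping a variable from a term
namespace LambdaTerm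

/-- Delete every maximal subterm all of whose leaves point to the variable `j`, together with
the application above it. The result is `none` if nothing remains. -/
def strip : {m : ℕ} → Fin (m + 1) → LambdaTerm (m + 1) → Option (LambdaTerm m)
  | _, j, var i => (finSuccEquiv' j i).map var
  | _, j, lam t => (strip j.succ t).map lam
  | _, j, app s t =>
    match strip j s, strip j t with
    | none, b => b
    | some a, none => some a
    | some a, some b => some (app a b)
  termination_by _ _ t => t.size
  decreasing_by all_goals simp only [size]; omega

/-- `strip` needs a distinguished variable, hence an index of the form `m + 1`, and the variable
moves to `j.succ` under an abstraction. Induction on size accommodates both. -/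
theorem succ_induction {P : ∀ m, Fin (m + 1) → LambdaTerm (m + 1) → Prop}
    (hvar : ∀ m j i, P m j (var i)) (hlam : ∀ m j t, P (m + 1) j.succ t → P m j (lam t))
    (happ : ∀ m j s t, P m j s → P m j t → P m j (app s t)) :
    ∀ m j t, P m j t
  | _, _, var _ => hvar _ _ _
  | _, _, lam t => hlam _ _ _ (succ_induction hvar hlam happ _ _ t)
  | _, _, app s t =>
    happ _ _ _ _ (succ_induction hvar hlam happ _ _ s) (succ_induction hvar hlam happ _ _ t)
  termination_by _ _ t => t.size
  decreasing_by all_goals simp only [size]; omega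

theorem strip_var_eq_none {m : ℕ} {j i : Fin (m + 1)} : strip j (var i) = none ↔ i = j := by
  rw [strip, Option.map_eq_none_iff, ← finSuccEquiv'_at j, (finSuccEquiv' j).apply_eq_iff_eq]

theorem strip_var_eq_some {m : ℕ} {j i : Fin (m + 1)} {c : LambdaTerm m} :
    strip j (var i) = some c ↔ ∃ k, i = j.succAbove k ∧ var k = c := by
  rw [strip, Option.map_eq_some_iff]
  refine exists_congr fun k => and_congr_left fun _ => ?_
  rw [← finSuccEquiv'_succAbove j k, (finSuccEquiv' j).apply_eq_iff_eq]

theorem strip_lam_eq_none {m : ℕ} {j : Fin (m + 1)} {t : LambdaTerm (m + 2)} :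
    strip j (lam t) = none ↔ strip j.succ t = none := by
  rw [strip, Option.map_eq_none_iff]

theorem strip_lam_eq_some {m : ℕ} {j : Fin (m + 1)} {t : LambdaTerm (m + 2)} {c : LambdaTerm m} :
    strip j (lam t) = some c ↔ ∃ d, strip j.succ t = some d ∧ lam d = c := by
  rw [strip, Option.map_eq_some_iff]

theorem strip_app_eq_none {m : ℕ} {j : Fin (m + 1)} {s t : LambdaTerm (m + 1)} :
    strip j (app s t) = none ↔ strip j s = none ∧ strip j t = none := by
  rw [strip]
  rcases strip j s with _ | a <;> rcases strip j t with _ | b <;> simp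

theorem strip_app_eq_some {m : ℕ} {j : Fin (m + 1)} {s t : LambdaTerm (m + 1)}
    {c : LambdaTerm m} : strip j (app s t) = some c ↔
      (∃ a b, strip j s = some a ∧ strip j t = some b ∧ app a b = c) ∨
      (strip j s = none ∧ strip j t = some c) ∨ (strip j s = some c ∧ strip j t = none) := by
  rw [strip]
  rcases strip j s with _ | a <;> rcases strip j t with _ | b <;> simp

/-- The set of terms over `m + 1` variables in which every leaf points to `j`. -/
def onlyVar {m : ℕ} (j : Fin (m + 1)) : Set (LambdaTerm (m + 1)) := {t | strip j t = none}

/-- The set of terms whose stripped term is `c`. -/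
def stripFiber {m : ℕ} (j : Fin (m + 1)) (c : LambdaTerm m) : Set (LambdaTerm (m + 1)) :=
  {t | strip j t = some c}

/-- The exponent counting nodes and occurrences of the variable `j`. -/
noncomputable def weight {m : ℕ} (j : Fin m) (t : LambdaTerm m) : Fin 2 →₀ ℕ :=
  bivExp t.size (t.occ j)

theorem finite_weight {m : ℕ} (j : Fin m) (e : Fin 2 →₀ ℕ) :
    {t : LambdaTerm m | t.weight j = e}.Finite :=
  (finite_size_le (e 0) m).subset fun _ h => ((eq_bivExp_iff _ _ _).1 h).1.le

theorem weight_lam {m : ℕ} (j : Fin m) (t : LambdaTerm (m + 1)) :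
    (lam t).weight j = bivExp 1 0 + t.weight j.succ := by
  simp [weight, size, occ, bivExp_add, add_comm]

theorem weight_app {m : ℕ} (j : Fin m) (s t : LambdaTerm m) :
    (app s t).weight j = bivExp 1 0 + (s.weight j + t.weight j) := by
  simp [weight, size, occ, bivExp_add, add_comm]

theorem lam_injective (m : ℕ) : Function.Injective (@lam m) := fun _ _ h => lam.inj h

theorem app_injective2 (m : ℕ) : Function.Injective2 (@app m) := fun _ _ _ _ h => app.inj h

theorem weightGF_lam {m : ℕ} (j : Fin m) (A : Set (LambdaTerm (m + 1))) :
    weightGF (weight j) (lam '' A) = zVar * weightGF (weight j.succ) A := by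
  rw [weightGF.image (lam_injective m) _ (weight_lam j), monomial_bivExp_one_zero]

theorem weightGF_app {m : ℕ} (j : Fin m) (A B : Set (LambdaTerm m)) :
    weightGF (weight j) (Set.image2 app A B) =
      zVar * (weightGF (weight j) A * weightGF (weight j) B) := by
  rw [weightGF.image2 (finite_weight j) (finite_weight j) (app_injective2 m) _ (weight_app j),
    monomial_bivExp_one_zero]

end LambdaTerm

/-! ### Terms with a single variable as Motzkin trees -/

/-- The term with underlying tree `t` in which every leaf points to `j`. -/
def MotzkinTree.toLambdaTerm : MotzkinTree → {m : ℕ} → Fin m → LambdaTerm m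
  | leaf, _, j => .var j
  | unary t, _, j => .lam (t.toLambdaTerm j.succ)
  | binary s t, _, j => .app (s.toLambdaTerm j) (t.toLambdaTerm j)

namespace MotzkinTree

theorem toLambdaTerm_injective {m : ℕ} (j : Fin m) :
    Function.Injective fun t : MotzkinTree => t.toLambdaTerm j := by
  intro s t h
  dsimp only at h
  induction s generalizing t m with
  | leaf => cases t <;> simp_all [toLambdaTerm]
  | unary s ih =>
    cases t with
    | unary t =>
      rw [toLambdaTerm, toLambdaTerm] at h
      rw [ih j.succ (LambdaTerm.lam.inj h)]
    | _ => simp [toLambdaTerm] at h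
  | binary s s' ih ih' =>
    cases t with
    | binary t t' =>
      rw [toLambdaTerm, toLambdaTerm] at h
      rw [ih j (LambdaTerm.app.inj h).1, ih' j (LambdaTerm.app.inj h).2]
    | _ => simp [toLambdaTerm] at h

theorem weight_toLambdaTerm {m : ℕ} (j : Fin m) (t : MotzkinTree) :
    (t.toLambdaTerm j).weight j = t.weight := by
  induction t generalizing m with
  | leaf => simp [toLambdaTerm, weight, LambdaTerm.weight, size, leaves, LambdaTerm.size,
      LambdaTerm.occ]
  | unary t ih =>
    rw [toLambdaTerm, LambdaTerm.weight_lam, ih]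
    simp [weight, size, leaves, bivExp_add, add_comm]
  | binary s t ih ih' =>
    rw [toLambdaTerm, LambdaTerm.weight_app, ih, ih']
    simp [weight, size, leaves, bivExp_add, add_comm]

theorem image_toLambdaTerm {m : ℕ} (j : Fin (m + 1)) :
    (fun t : MotzkinTree => t.toLambdaTerm j) '' Set.univ = LambdaTerm.onlyVar j := by
  rw [Set.image_univ]
  refine Set.Subset.antisymm ?_ fun t => ?_
  · rintro _ ⟨t, rfl⟩
    change LambdaTerm.strip j (t.toLambdaTerm j) = none
    induction t generalizing m with
    | leaf => exact LambdaTerm.strip_var_eq_none.2 rfl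
    | unary t ih => exact LambdaTerm.strip_lam_eq_none.2 (ih _)
    | binary s t ih ih' => exact LambdaTerm.strip_app_eq_none.2 ⟨ih _, ih' _⟩
  · induction m, j, t using LambdaTerm.succ_induction with
    | hvar m j i =>
      intro h
      exact ⟨leaf, congrArg LambdaTerm.var (LambdaTerm.strip_var_eq_none.1 h).symm⟩
    | hlam m j t ih =>
      intro h
      obtain ⟨s, rfl⟩ := ih (LambdaTerm.strip_lam_eq_none.1 h)
      exact ⟨unary s, rfl⟩
    | happ m j s t ih ih' =>
      intro h
      obtain ⟨h1, h2⟩ := LambdaTerm.strip_app_eq_none.1 h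
      obtain ⟨a, rfl⟩ := ih h1
      obtain ⟨b, rfl⟩ := ih' h2
      exact ⟨binary a b, rfl⟩

end MotzkinTree

/-! ### Generating function of the terms with a given stripped term -/

namespace LambdaTerm

theorem weightGF_onlyVar {m : ℕ} (j : Fin (m + 1)) :
    weightGF (weight j) (onlyVar j) = motzkinGF := by
  rw [← MotzkinTree.image_toLambdaTerm, weightGF.image (w := MotzkinTree.weight)
    (MotzkinTree.toLambdaTerm_injective j) 0
    (fun t => by rw [MotzkinTree.weight_toLambdaTerm, zero_add]), motzkinGF_eq_weightGF,
    MvPowerSeries.monomial_zero_one, one_mul]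

theorem disjoint_onlyVar_stripFiber {m : ℕ} (j : Fin (m + 1)) (c : LambdaTerm m) :
    Disjoint (onlyVar j) (stripFiber j c) :=
  Set.disjoint_left.2 fun _ h h' => by
    rw [onlyVar, Set.mem_ofPred_eq] at h
    rw [stripFiber, Set.mem_ofPred_eq, h] at h'
    exact nomatch h'

/-- A term with stripped term `c` is either a core, or it has a deleted subterm at its root. -/
theorem weightGF_stripFiber_eq {m : ℕ} {j : Fin (m + 1)} {c : LambdaTerm m}
    {A : Set (LambdaTerm (m + 1))} {P : BivSeries}
    (hA : weightGF (weight j) A = zVar * P)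
    (hc : stripFiber j c = A ∪ (Set.image2 app (onlyVar j) (stripFiber j c) ∪
      Set.image2 app (stripFiber j c) (onlyVar j)))
    (h1 : Disjoint A (Set.image2 app (onlyVar j) (stripFiber j c) ∪
      Set.image2 app (stripFiber j c) (onlyVar j))) :
    weightGF (weight j) (stripFiber j c) = motzkinArg * P := by
  have h2 : Disjoint (Set.image2 app (onlyVar j) (stripFiber j c))
      (Set.image2 app (stripFiber j c) (onlyVar j)) := by
    rw [Set.disjoint_left]
    rintro _ ⟨s, hs, t, ht, rfl⟩ ⟨s', hs', t', ht', h⟩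
    obtain ⟨rfl, rfl⟩ := app.inj h
    exact (disjoint_onlyVar_stripFiber j c).notMem_of_mem_left hs hs'
  have h := congrArg (weightGF (weight j)) hc
  rw [weightGF.union (finite_weight j) h1, weightGF.union (finite_weight j) h2, weightGF_app,
    weightGF_app, weightGF_onlyVar, hA] at h
  rw [motzkinArg]
  -- The fibre series `W` satisfies `W = z P + 2 z M W`; this solves for `W`.
  linear_combination (1 - 2 * zVar * motzkinGF)⁻¹ * h -
    weightGF (weight j) (stripFiber j c) * motzkinArg_denominator_mul_inv

theorem mem_image2_strip_iff {m : ℕ} {j : Fin (m + 1)} {c : LambdaTerm m}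
    {s t : LambdaTerm (m + 1)} :
    app s t ∈ Set.image2 app (onlyVar j) (stripFiber j c) ∪
      Set.image2 app (stripFiber j c) (onlyVar j) ↔
    (strip j s = none ∧ strip j t = some c) ∨ (strip j s = some c ∧ strip j t = none) := by
  rw [Set.mem_union, Set.mem_image2_iff (app_injective2 _), Set.mem_image2_iff (app_injective2 _)]
  rfl

/-- Each node of `c` contributes one factor `z / (1 - 2 z M)`: the node itself, preceded by any
number of deleted subterms on either side. Nodes of `c` carry no `u`, since `c` does not contain
`j`. -/
theorem weightGF_stripFiber {m : ℕ} (j : Fin (m + 1)) (c : LambdaTerm m) :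
    weightGF (weight j) (stripFiber j c) = motzkinArg ^ c.size := by
  induction c with
  | @var m i =>
    have hA : weightGF (weight j) {var (j.succAbove i)} = zVar * 1 := by
      rw [weightGF.singleton, weight, size, occ, if_neg (Fin.succAbove_ne j i),
        monomial_bivExp_one_zero, mul_one]
    rw [weightGF_stripFiber_eq hA, size, mul_one, pow_one]
    · ext t
      cases t with
      | var k =>
        simp only [stripFiber, Set.mem_ofPred_eq, strip_var_eq_some]
        simp
      | lam t =>
        simp only [stripFiber, Set.mem_ofPred_eq, strip_lam_eq_some]
        simp
      | app s t =>
        rw [Set.mem_union, mem_image2_strip_iff]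
        simp only [stripFiber, Set.mem_ofPred_eq, strip_app_eq_some]
        simp
    · simp
  | @lam m c ih =>
    have hA := weightGF_lam j (stripFiber j.succ c)
    rw [weightGF_stripFiber_eq hA, ih, size, pow_succ']
    · ext t
      cases t with
      | var k =>
        simp only [stripFiber, Set.mem_ofPred_eq, strip_var_eq_some]
        simp
      | lam t =>
        simp only [stripFiber, Set.mem_ofPred_eq, strip_lam_eq_some]
        simp
      | app s t =>
        rw [Set.mem_union, mem_image2_strip_iff]
        simp only [stripFiber, Set.mem_ofPred_eq, strip_app_eq_some]
        simp
    · rw [Set.disjoint_left]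
      rintro _ ⟨t, -, rfl⟩
      simp
  | @app m a b ih ih' =>
    have hA := weightGF_app j (stripFiber j a) (stripFiber j b)
    rw [weightGF_stripFiber_eq hA, ih, ih', size, ← pow_add, pow_succ']
    · ext t
      cases t with
      | var k =>
        simp only [stripFiber, Set.mem_ofPred_eq, strip_var_eq_some]
        simp
      | lam t =>
        simp only [stripFiber, Set.mem_ofPred_eq, strip_lam_eq_some]
        simp
      | app s t =>
        rw [Set.mem_union, mem_image2_strip_iff, Set.mem_image2_iff (app_injective2 _)]
        simp only [stripFiber, Set.mem_ofPred_eq, strip_app_eq_some]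
        simp
    · rw [Set.disjoint_left]
      rintro _ ⟨s, hs, t, ht, rfl⟩
      rw [mem_image2_strip_iff, show strip j s = _ from hs, show strip j t = _ from ht]
      simp

/-- All leaves point to `j`, so the abstractions inside `t` bind nothing. -/
theorem strip_none {m : ℕ} {j : Fin (m + 1)} {t : LambdaTerm (m + 1)} (h : strip j t = none)
    (p : ℕ) : (∀ i, t.occ (j.succAbove i) = 0) ∧ BindsAtMost p t := by
  induction m, j, t using succ_induction with
  | hvar m j i =>
    rw [strip_var_eq_none.1 h]
    exact ⟨fun k => if_neg (Fin.succAbove_ne j k).symm, trivial⟩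
  | hlam m j t ih =>
    obtain ⟨h1, h2⟩ := ih (strip_lam_eq_none.1 h)
    refine ⟨fun i => ?_, ?_, h2⟩
    · rw [occ, ← Fin.succ_succAbove_succ, h1]
    -- Under the abstraction `j` becomes `j.succ`, and the newly bound variable `0` is
    -- `j.succ.succAbove 0`, one of the variables covered by the induction hypothesis.
    · have := h1 0
      rw [Fin.succ_succAbove_zero] at this
      rw [this]
      exact zero_le
  | happ m j s t ih ih' =>
    obtain ⟨h1, h2⟩ := strip_app_eq_none.1 h
    exact ⟨fun i => by rw [occ, (ih h1).1, (ih' h2).1], (ih h1).2, (ih' h2).2⟩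

/-- Deleted subterms have leaves pointing only to `j`, so the occurrences of every other variable,
bound ones included, survive. The size bound later makes the sum over stripped terms finite in each
degree. -/
theorem strip_some {m : ℕ} {j : Fin (m + 1)} {t : LambdaTerm (m + 1)} {c : LambdaTerm m}
    (h : strip j t = some c) (p : ℕ) : (∀ i, t.occ (j.succAbove i) = c.occ i) ∧
      (BindsAtMost p t ↔ BindsAtMost p c) ∧ c.size ≤ t.size := by
  induction m, j, t using succ_induction with
  | hvar m j i =>
    obtain ⟨k, rfl, rfl⟩ := strip_var_eq_some.1 h
    exact ⟨fun i => by simp [occ], Iff.rfl, le_rfl⟩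
  | hlam m j t ih =>
    obtain ⟨d, hd, rfl⟩ := strip_lam_eq_some.1 h
    obtain ⟨h1, h2, h3⟩ := ih hd
    refine ⟨fun i => ?_, ?_, Nat.succ_le_succ h3⟩
    · rw [occ, occ, ← Fin.succ_succAbove_succ, h1]
    · have := h1 0
      rw [Fin.succ_succAbove_zero] at this
      rw [BindsAtMost, BindsAtMost, this, h2]
  | happ m j s t ih ih' =>
    rcases strip_app_eq_some.1 h with ⟨a, b, ha, hb, rfl⟩ | ⟨ha, hb⟩ | ⟨ha, hb⟩
    · obtain ⟨h1, h2, h3⟩ := ih ha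
      obtain ⟨h1', h2', h3'⟩ := ih' hb
      refine ⟨fun i => by rw [occ, occ, h1, h1'], by rw [BindsAtMost, BindsAtMost, h2, h2'], ?_⟩
      rw [size, size]
      omega
    · obtain ⟨h1, h2⟩ := strip_none ha p
      obtain ⟨h1', h2', h3'⟩ := ih' hb
      refine ⟨fun i => by rw [occ, h1, h1', zero_add], by rw [BindsAtMost, h2', and_iff_right h2], ?_⟩
      rw [size]
      omega
    · obtain ⟨h1, h2⟩ := strip_none hb p
      obtain ⟨h1', h2', h3'⟩ := ih ha
      refine ⟨fun i => by rw [occ, h1, h1', add_zero], by rw [BindsAtMost, h2', and_iff_left h2], ?_⟩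
      rw [size]
      omega

end LambdaTerm
-- Substitution as a sum over stripped terms
theorem coeff_zVar_pow_mul_of_lt {n : ℕ} {e : Fin 2 →₀ ℕ} (h : e 0 < n) (G : BivSeries) :
    MvPowerSeries.coeff e (zVar ^ n * G) = 0 := by
  classical
  rw [zVar, MvPowerSeries.X_pow_eq, MvPowerSeries.coeff_monomial_mul, if_neg]
  intro hle
  have := hle 0
  rw [Finsupp.single_eq_same] at this
  omega

theorem coeff_motzkinArg_pow_of_lt {n : ℕ} {e : Fin 2 →₀ ℕ} (h : e 0 < n) :
    MvPowerSeries.coeff e (motzkinArg ^ n) = 0 := by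
  rw [motzkinArg, mul_pow, coeff_zVar_pow_mul_of_lt h]

theorem coeff_subst_motzkinArg (F : PowerSeries ℝ) (e : Fin 2 →₀ ℕ) :
    MvPowerSeries.coeff e (PowerSeries.subst motzkinArg F) = ∑ n ∈ Finset.range (e 0 + 1),
      PowerSeries.coeff n F * MvPowerSeries.coeff e (motzkinArg ^ n) := by
  rw [PowerSeries.coeff_subst motzkinArg_hasSubst]
  refine finsum_eq_sum_of_support_subset _ fun n hn => ?_
  by_contra h
  refine hn ?_
  rw [Finset.coe_range, Set.mem_Iio] at h
  dsimp only
  rw [coeff_motzkinArg_pow_of_lt (by omega), smul_zero]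

namespace LambdaTerm

/-- The fibres over distinct `c` are disjoint, so the left side is the sum of `motzkinArg ^ c.size`
over `c ∈ BCK p`. Only `c` of size at most `e 0` reach the exponent `e`; grouping them by size
produces the coefficients of `bckGF p`. -/
theorem weightGF_iUnion_stripFiber (p : ℕ) :
    weightGF (weight 0) {t : LambdaTerm 1 | ∃ c ∈ BCK p, strip 0 t = some c} =
      PowerSeries.subst motzkinArg (bckGF p) := by
  classical
  ext e
  have hC : {c : LambdaTerm 0 | c ∈ BCK p ∧ c.size ≤ e 0}.Finite :=
    (finite_size_le (e 0) 0).subset fun _ h => h.2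
  have key : {t | t ∈ {t : LambdaTerm 1 | ∃ c ∈ BCK p, strip 0 t = some c} ∧ t.weight 0 = e} =
      (hC.toFinset.biUnion fun c =>
        (weightGF.finite_fiber (finite_weight 0) (stripFiber 0 c) e).toFinset :
          Finset (LambdaTerm 1)) := by
    ext t
    simp only [Set.mem_ofPred_eq, Finset.coe_biUnion, Set.mem_iUnion, Finset.mem_coe,
      Set.Finite.mem_toFinset, exists_prop]
    constructor
    · rintro ⟨⟨c, hc, h⟩, he⟩
      refine ⟨c, ⟨hc, ?_⟩, h, he⟩
      rw [← ((eq_bivExp_iff _ _ _).1 he).1]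
      exact (strip_some h p).2.2
    · rintro ⟨c, ⟨hc, -⟩, h, he⟩
      exact ⟨⟨c, hc, h⟩, he⟩
  rw [weightGF.coeff_eq, key, Set.ncard_coe_finset, Finset.card_biUnion, Nat.cast_sum,
    coeff_subst_motzkinArg]
  · have hsum : ∀ c ∈ hC.toFinset,
        ((weightGF.finite_fiber (finite_weight 0) (stripFiber 0 c) e).toFinset.card : ℝ) =
          MvPowerSeries.coeff e (motzkinArg ^ c.size) := fun c _ => by
      rw [← weightGF_stripFiber 0 c, weightGF.coeff_eq,
        Set.ncard_eq_toFinset_card _ (weightGF.finite_fiber (finite_weight 0) _ e)]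
    rw [Finset.sum_congr rfl hsum, ← Finset.sum_fiberwise_of_maps_to
      (g := fun c : LambdaTerm 0 => c.size) (t := Finset.range (e 0 + 1))]
    · refine Finset.sum_congr rfl fun n hn => ?_
      rw [Finset.mem_range] at hn
      rw [Finset.sum_congr rfl (g := fun _ => MvPowerSeries.coeff e (motzkinArg ^ n)),
        Finset.sum_const, nsmul_eq_mul, bckGF, PowerSeries.coeff_mk]
      · congr 2
        rw [Set.ncard_eq_toFinset_card _ (BCK_finite p n)]
        congr 1
        ext c
        simp only [Finset.mem_filter, Set.Finite.mem_toFinset, Set.mem_ofPred_eq]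
        constructor
        · exact fun h => ⟨h.1.1, h.2⟩
        · exact fun h => ⟨⟨h.1, by omega⟩, h.2⟩
      · intro c hc
        rw [(Finset.mem_filter.1 hc).2]
    · intro c hc
      rw [Set.Finite.mem_toFinset] at hc
      exact Finset.mem_range.2 (Nat.lt_succ_of_le hc.2)
  · intro c _ d _ hne
    rw [Function.onFun, Finset.disjoint_left]
    intro t h h'
    rw [Set.Finite.mem_toFinset] at h h'
    exact hne (Option.some.inj ((show strip 0 t = some c from h.1).symm.trans h'.1))

/-- Terms with one free variable, counted by size and occurrences of the variable. -/
theorem weightGF_bindsAtMost (p : ℕ) :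
    weightGF (weight 0) {t : LambdaTerm 1 | t.BindsAtMost p} =
      motzkinGF + PowerSeries.subst motzkinArg (bckGF p) := by
  rw [← weightGF_onlyVar (0 : Fin 1), ← weightGF_iUnion_stripFiber,
    ← weightGF.union (finite_weight 0)]
  · congr 1
    ext t
    simp only [onlyVar, BCK, Set.mem_union, Set.mem_ofPred_eq]
    rcases h : strip 0 t with _ | c
    · simpa using (strip_none h p).2
    · simpa using (strip_some h p).2.1
  · refine Set.disjoint_left.2 ?_
    rintro t h ⟨c, -, h'⟩
    rw [show strip 0 t = none from h] at h'
    exact nomatch h'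

end LambdaTerm

/-! ### Extracting coefficients in `u` -/

theorem coeff_uCoeff (p n : ℕ) (G : BivSeries) :
    PowerSeries.coeff n (uCoeff p G) = MvPowerSeries.coeff (bivExp n p) G :=
  PowerSeries.coeff_mk _ _

theorem uCoeff_add (p : ℕ) (G H : BivSeries) :
    uCoeff p (G + H) = uCoeff p G + uCoeff p H := by
  ext n
  simp only [coeff_uCoeff, map_add]

theorem uCoeff_zero_uVar_mul (G : BivSeries) : uCoeff 0 (uVar * G) = 0 := by
  classical
  ext n
  rw [coeff_uCoeff, uVar, MvPowerSeries.X, MvPowerSeries.coeff_monomial_mul, if_neg, map_zero]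
  intro h
  simpa using h 1

theorem uCoeff_succ_uVar_mul (p : ℕ) (G : BivSeries) :
    uCoeff (p + 1) (uVar * G) = uCoeff p G := by
  ext n
  rw [coeff_uCoeff, coeff_uCoeff, uVar, MvPowerSeries.X, bivExp, Finsupp.single_add, ← add_assoc,
    add_comm, MvPowerSeries.coeff_add_monomial_mul, one_mul, bivExp]

theorem X_pow_dvd_uCoeff (p n : ℕ) {G : BivSeries} (h : zVar ^ n ∣ G) :
    PowerSeries.X ^ n ∣ uCoeff p G := by
  obtain ⟨H, rfl⟩ := h
  refine PowerSeries.X_pow_dvd_iff.2 fun k hk => ?_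
  rw [coeff_uCoeff, coeff_zVar_pow_mul_of_lt (by simpa using hk)]

theorem uCoeff_zero_mul_inv (G : BivSeries) : uCoeff 0 (G * (1 - uVar)⁻¹) = uCoeff 0 G := by
  -- The quotient `H = G / (1 - u)` satisfies `H = G + u H`, so its coefficients in `u` are the
  -- partial sums of those of `G`.
  have h : G * (1 - uVar)⁻¹ = G + uVar * (G * (1 - uVar)⁻¹) := by
    linear_combination G * one_sub_uVar_mul_inv
  rw [h, uCoeff_add, uCoeff_zero_uVar_mul, add_zero]

theorem uCoeff_succ_mul_inv (p : ℕ) (G : BivSeries) :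
    uCoeff (p + 1) (G * (1 - uVar)⁻¹) = uCoeff (p + 1) G + uCoeff p (G * (1 - uVar)⁻¹) := by
  have h : G * (1 - uVar)⁻¹ = G + uVar * (G * (1 - uVar)⁻¹) := by
    linear_combination G * one_sub_uVar_mul_inv
  conv_lhs => rw [h, uCoeff_add, uCoeff_succ_uVar_mul]

/-! ### Decomposing closed terms at the root -/

namespace LambdaTerm

/-- The exponent counting nodes. -/
noncomputable def sizeWeight {m : ℕ} (t : LambdaTerm m) : Unit →₀ ℕ := Finsupp.single () t.size

theorem sizeWeight_eq_iff {m : ℕ} (t : LambdaTerm m) (n : ℕ) :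
    t.sizeWeight = Finsupp.single () n ↔ t.size = n :=
  (Finsupp.single_injective ()).eq_iff

theorem finite_sizeWeight (m : ℕ) (e : Unit →₀ ℕ) :
    {t : LambdaTerm m | t.sizeWeight = e}.Finite :=
  (finite_size_le (e ()) m).subset fun t h => by
    rw [Set.mem_ofPred_eq] at h ⊢
    rw [← h, sizeWeight, Finsupp.single_eq_same]

theorem uCoeff_weightGF (k : ℕ) (A : Set (LambdaTerm 1)) :
    uCoeff k (weightGF (weight 0) A) = weightGF sizeWeight {t | t ∈ A ∧ t.occ 0 = k} := by
  ext n
  rw [coeff_uCoeff, weightGF.coeff_eq, PowerSeries.coeff, weightGF.coeff_eq]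
  congr 2
  ext t
  simp only [Set.mem_ofPred_eq, weight, eq_bivExp_iff, bivExp_zero, bivExp_one, sizeWeight_eq_iff]
  tauto

/-- Partial sums over the exponent of `u` turn "exactly `k` occurrences" into "at most `p`
occurrences". -/
theorem uCoeff_weightGF_mul_inv (p : ℕ) (A : Set (LambdaTerm 1)) :
    uCoeff p (weightGF (weight 0) A * (1 - uVar)⁻¹) =
      weightGF sizeWeight {t | t ∈ A ∧ t.occ 0 ≤ p} := by
  induction p with
  | zero => simp only [uCoeff_zero_mul_inv, uCoeff_weightGF, Nat.le_zero]
  | succ p ih =>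
    rw [uCoeff_succ_mul_inv, ih, uCoeff_weightGF, ← weightGF.union (finite_sizeWeight 1)]
    · congr 1
      ext t
      simp only [Set.mem_union, Set.mem_ofPred_eq, Nat.le_succ_iff]
      tauto
    · refine Set.disjoint_left.2 fun t h h' => ?_
      have h1 := h.2
      have h2 := h'.2
      omega

theorem bckGF_eq_weightGF (p : ℕ) : bckGF p = weightGF sizeWeight (BCK p) := by
  ext n
  rw [bckGF, PowerSeries.coeff_mk, PowerSeries.coeff, weightGF.coeff_eq]
  simp only [sizeWeight_eq_iff]

theorem BCK_eq (p : ℕ) : BCK p =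
    lam '' {t : LambdaTerm 1 | t ∈ {t : LambdaTerm 1 | t.BindsAtMost p} ∧ t.occ 0 ≤ p} ∪
      Set.image2 app (BCK p) (BCK p) := by
  ext t
  cases t with
  | var i => exact i.elim0
  | lam t =>
    rw [Set.mem_union, (lam_injective 0).mem_set_image]
    simp [BCK, BindsAtMost, and_comm]
  | app s t =>
    rw [Set.mem_union, Set.mem_image2_iff (app_injective2 _)]
    simp [BCK, BindsAtMost]

theorem bckGF_eq (p : ℕ) : bckGF p =
    PowerSeries.X * uCoeff p ((motzkinGF + PowerSeries.subst motzkinArg (bckGF p)) *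
      (1 - uVar)⁻¹) + PowerSeries.X * bckGF p ^ 2 := by
  have hd : Disjoint
      (lam '' {t : LambdaTerm 1 | t ∈ {t : LambdaTerm 1 | t.BindsAtMost p} ∧ t.occ 0 ≤ p})
      (Set.image2 app (BCK p) (BCK p)) := by
    rw [Set.disjoint_left]
    rintro _ ⟨t, -, rfl⟩
    simp
  have h := congrArg (weightGF sizeWeight) (BCK_eq p)
  rw [weightGF.union (finite_sizeWeight 0) hd,
    weightGF.image (w := sizeWeight) (lam_injective 0) (Finsupp.single () 1)
      (fun t => by rw [sizeWeight, sizeWeight, size, add_comm, Finsupp.single_add]),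
    weightGF.image2 (finite_sizeWeight 0) (finite_sizeWeight 0) (app_injective2 0)
      (Finsupp.single () 1) (fun s t => by
        rw [sizeWeight, sizeWeight, sizeWeight, size, add_comm, Finsupp.single_add,
          Finsupp.single_add]),
    ← uCoeff_weightGF_mul_inv, weightGF_bindsAtMost, ← bckGF_eq_weightGF, ← sq] at h
  exact h

end LambdaTerm

/-! ### Uniqueness of the solution -/

theorem zVar_pow_dvd_subst_motzkinArg {n : ℕ} {F : PowerSeries ℝ} (h : PowerSeries.X ^ n ∣ F) :
    zVar ^ n ∣ PowerSeries.subst motzkinArg F := by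
  obtain ⟨G, rfl⟩ := h
  rw [PowerSeries.subst_mul motzkinArg_hasSubst, PowerSeries.subst_pow motzkinArg_hasSubst,
    PowerSeries.subst_X motzkinArg_hasSubst]
  exact (pow_dvd_pow_of_dvd (dvd_mul_right _ _) n).mul_right _

/-- Substitution is additive, so `F - G` equals `X` times an expression that is divisible by `X ^ n`
whenever `F - G` is. Hence every power of `X` divides `F - G`. -/
theorem eq_of_functional_equation {p : ℕ} {C F G : PowerSeries ℝ}
    (hF : F = C + PowerSeries.X * F ^ 2 +
      PowerSeries.X * uCoeff p ((1 - uVar)⁻¹ * PowerSeries.subst motzkinArg F))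
    (hG : G = C + PowerSeries.X * G ^ 2 +
      PowerSeries.X * uCoeff p ((1 - uVar)⁻¹ * PowerSeries.subst motzkinArg G)) : F = G := by
  have hsub : uCoeff p ((1 - uVar)⁻¹ * PowerSeries.subst motzkinArg F) =
      uCoeff p ((1 - uVar)⁻¹ * PowerSeries.subst motzkinArg (F - G)) +
        uCoeff p ((1 - uVar)⁻¹ * PowerSeries.subst motzkinArg G) := by
    rw [← uCoeff_add, ← mul_add, ← PowerSeries.subst_add motzkinArg_hasSubst, sub_add_cancel]
  have hD : F - G = PowerSeries.X * ((F - G) * (F + G) +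
      uCoeff p ((1 - uVar)⁻¹ * PowerSeries.subst motzkinArg (F - G))) := by
    linear_combination hF - hG + PowerSeries.X * hsub
  have hdvd : ∀ n, PowerSeries.X ^ n ∣ F - G := by
    intro n
    induction n with
    | zero => rw [pow_zero]; exact one_dvd _
    | succ n ih =>
      rw [hD, pow_succ']
      exact mul_dvd_mul_left _ (dvd_add (ih.mul_right _)
        (X_pow_dvd_uCoeff p n ((zVar_pow_dvd_subst_motzkinArg ih).mul_left _)))
  refine sub_eq_zero.1 (PowerSeries.ext fun n => ?_)
  rw [PowerSeries.X_pow_dvd_iff.1 (hdvd (n + 1)) n n.lt_succ_self, map_zero]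

theorem bckGF_functional_equation (p : ℕ) :
    bckGF p = PowerSeries.X * uCoeff p (motzkinGF * (1 - uVar)⁻¹)
      + PowerSeries.X * bckGF p ^ 2
      + PowerSeries.X * uCoeff p ((1 - uVar)⁻¹ * PowerSeries.subst motzkinArg (bckGF p)) := by
  have h := LambdaTerm.bckGF_eq p
  rw [add_mul, uCoeff_add, mul_comm (PowerSeries.subst _ _)] at h
  linear_combination h

theorem mainTheorem7 :
    -- `M` is the unique power series solution of `M = u z + z M + z M ^ 2`
    (∀ N : BivSeries, N = uVar * zVar + zVar * N + zVar * N ^ 2 ↔ N = motzkinGF) ∧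
    -- `M = (1 - z - √((1 - z) ^ 2 - 4 u z ^ 2)) / (2 z)`
    (∃ S : BivSeries, MvPowerSeries.constantCoeff S = 1 ∧
      S ^ 2 = (1 - zVar) ^ 2 - 4 * uVar * zVar ^ 2 ∧
      2 * zVar * motzkinGF = 1 - zVar - S) ∧
    -- `F_p` is the unique power series solution of the functional equation
    (∀ (p : ℕ) (F : PowerSeries ℝ),
      F = PowerSeries.X * uCoeff p (motzkinGF * (1 - uVar)⁻¹)
          + PowerSeries.X * F ^ 2
          + PowerSeries.X * uCoeff p ((1 - uVar)⁻¹ * PowerSeries.subst motzkinArg F) ↔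
        F = bckGF p) :=
  ⟨eq_motzkinGF_iff, exists_sqrt_motzkinGF, fun p _ =>
    ⟨fun h => eq_of_functional_equation h (bckGF_functional_equation p),
      fun h => h ▸ bckGF_functional_equation p⟩⟩
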